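/- All graphs are simple. The square $G^2$ of a graph $G$ has the same vertex set as $G$, and two distinct vertices are adjacent in $G^2$ iff their distance in $G$ is at most $2$. A straight-line drawing of $G$ maps the vertices injectively to points of the plane and each edge to the line segment joining the images of its ends; it is crossing-free if no vertex lies in the interior of an edge and the interiors of distinct edges are disjoint. A segment of such a drawing is an inclusion-maximal set of edges that together form a line segment, and the segment number of the drawing is the number of its segments. For a planar graph $G$, $\operatorname{seg}(G)$ is the smallest segment number over all crossing-free straight-line drawings of $G$. Proposition. Let $n\ge 6$ be even and let $C_n$ be the cycle on $n$ vertices. Then $C_n^2$ is planar, $4$-regular and $3$-connected, and $\operatorname{seg}(C_n^2)\ge n$. Consequently, the universal upper bound of $n+3$ segments for $3$-connected $4$-regular planar graphs on $n$ vertices cannot be improved by more than the additive constant $3$ for any even $n\ge 6$: if $b$ is a natural number such that every $3$-connected $4$-regular planar graph on $n$ vertices has a crossing-free straight-line drawing with at most $b$ segments, then $b\ge (n+3)-3$. -/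

import Mathlib

/-- The Euclidean plane. -/
abbrev Plane : Type := EuclideanSpace ℝ (Fin 2)

namespace SimpleGraph

variable {V : Type*}

/-- The square of a graph: same vertex set, and two distinct vertices are adjacent iff their
distance is at most two (the extended distance is infinite between different components). -/
def square (G : SimpleGraph V) : SimpleGraph V where
  Adj u v := u ≠ v ∧ G.edist u v ≤ 2
  symm := ⟨fun _ _ h => ⟨h.1.symm, SimpleGraph.edist_comm (G := G) ▸ h.2⟩⟩
  loopless := ⟨fun _ h => h.1 rfl⟩

/-- `k`-connectedness (in the sense of vertex connectivity): there are more than `k` vertices, and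
deleting fewer than `k` vertices always leaves a connected graph. -/
def IsVertexConnected (G : SimpleGraph V) (k : ℕ) : Prop :=
  (k : ℕ∞) < ENat.card V ∧ ∀ S : Finset V, S.card < k → (G.induce (S : Set V)ᶜ).Connected

/-- A planar (topological) drawing: vertices are distinct points of the plane, every edge is a
simple arc joining its two ends whose interior avoids all vertices, and the interiors of the arcs
of different edges are disjoint. -/
structure PlanarDrawing (G : SimpleGraph V) where
  pos : V → Plane
  pos_injective : Function.Injective pos
  arc : G.edgeSet → C(unitInterval, Plane)
  arc_injective : ∀ e, Function.Injective (arc e)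
  arc_ends : ∀ e, {arc e 0, arc e 1} = pos '' {v | v ∈ (e : Sym2 V)}
  arc_avoids : ∀ e, ∀ t ∈ Set.Ioo (0 : unitInterval) 1, ∀ v, arc e t ≠ pos v
  arc_disjoint : ∀ e f, e ≠ f → Disjoint (arc e '' Set.Ioo 0 1) (arc f '' Set.Ioo 0 1)

/-- A graph is planar if it has a planar drawing. -/
def IsPlanar (G : SimpleGraph V) : Prop := Nonempty G.PlanarDrawing

/-- A straight-line drawing: the vertices are mapped injectively to points of the plane; the edge
`ab` is drawn as the line segment between the images of `a` and `b`. -/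
structure StraightLineDrawing (_G : SimpleGraph V) where
  pos : V → Plane
  pos_injective : Function.Injective pos

namespace StraightLineDrawing

variable {G : SimpleGraph V}

/-- A straight-line drawing is crossing-free if no vertex lies in the interior of an edge and the
interiors of different edges are disjoint. -/
def CrossingFree (D : G.StraightLineDrawing) : Prop :=
  (∀ a b v, G.Adj a b → D.pos v ∉ openSegment ℝ (D.pos a) (D.pos b)) ∧
  (∀ a b c d, G.Adj a b → G.Adj c d → s(a, b) ≠ s(c, d) →
    Disjoint (openSegment ℝ (D.pos a) (D.pos b)) (openSegment ℝ (D.pos c) (D.pos d)))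

/-- The part of the plane covered by a set of edges. -/
def cover (D : G.StraightLineDrawing) (S : Set (Sym2 V)) : Set Plane :=
  {z | ∃ a b, s(a, b) ∈ S ∧ z ∈ segment ℝ (D.pos a) (D.pos b)}

/-- A set of edges that together form a line segment. -/
def FormsLineSegment (D : G.StraightLineDrawing) (S : Set (Sym2 V)) : Prop :=
  S ⊆ G.edgeSet ∧ ∃ x y : Plane, D.cover S = segment ℝ x y

/-- The segments of a drawing: the inclusion-maximal sets of edges that together form a line
segment. -/
def segments (D : G.StraightLineDrawing) : Set (Set (Sym2 V)) :=
  {S | Maximal D.FormsLineSegment S}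

/-- The segment number of a drawing (of a finite graph). -/
noncomputable def segmentNumber (D : G.StraightLineDrawing) : ℕ := D.segments.ncard

end StraightLineDrawing

/-- The segment number of a (finite planar) graph: the smallest segment number of its crossing-free
straight-line drawings. By convention it is `0` if there is no such drawing. -/
noncomputable def segmentNumber (G : SimpleGraph V) : ℕ :=
  sInf {k | ∃ D : G.StraightLineDrawing, D.CrossingFree ∧ D.segmentNumber = k}

end SimpleGraph

/-!
The lower bound rests on counting segment ends. Call a pair of a vertex `v` and an edge `vw` an end
if no edge at `v` prolongs `vw` beyond `v`. A segment of a crossing-free drawing has at most two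
ends (`card_le_two_mul_segmentNumber`), so it suffices to find `2 * n` ends.

At the vertex `k` of the square of the cycle, two edges can be aligned only if their other ends are
not adjacent, which leaves the pairs `L` (towards `k - 2` and `k + 1`), `R` (towards `k - 1` and
`k + 2`) and `O` (towards `k - 2` and `k + 2`). The pair `O` excludes the other two. Hence a vertex
is responsible for at least two ends, unless both `L` and `R` are aligned there, when it has none;
where nothing is aligned, it has four. It remains to see that vertices of the last kind are at least
as numerous as those with `L` and `R`, and for this that between two consecutive vertices of type
`L` and `R` (going around the cycle) there is always one without alignments
(`StripDrawing.exists_not_aligned_between`). Otherwise, between the two, there would be an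
alignment `R` followed by some `O`s followed by an `L`. But `R` at `s + 1` and `O` at the vertices
from `s + 2` on force the points to lie alternately on two rays from the point `s`, and a final `L`
would put one point on both rays (`StripDrawing.not_alignedR_alignedO_alignedL`). No embedding
theorem and no property of the outer face is needed; only the condition that vertices avoid edges
enters this part.

The segment number is an infimum of natural numbers, which would be `0` for want of a drawing, so a
crossing-free straight-line drawing is constructed. For even `n`, the path square on `1, …, n - 1`
is drawn as a zigzag strip with the even vertices on a line and the odd ones on a flat convex
parabola above it; the vertex `0` is placed far below. Any two edges are separated by a line:
a line through two consecutive points of the strip, a side of the outer triangle `0, 1, n - 1`, or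
one of two axis-parallel lines. This drawing also shows planarity. For connectivity, one walks once
around the cycle, stepping over deleted vertices.
-/

/-! ### Points on a line -/

section Line

variable {E : Type*} [AddCommGroup E] [Module ℝ E]

theorem add_smul_mem_openSegment (a d : E) {r s t : ℝ} (hrs : r < s) (hst : s < t) :
    a + s • d ∈ openSegment ℝ (a + r • d) (a + t • d) := by
  have h : 0 < t - r := by linarith
  refine ⟨(t - s) / (t - r), (s - r) / (t - r), by apply div_pos <;> linarith,
    by apply div_pos <;> linarith, by field_simp; ring, ?_⟩
  rw [smul_add, smul_add, smul_smul, smul_smul]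
  rw [add_add_add_comm, ← add_smul, ← add_smul]
  congr 2
  · rw [← add_div, show t - s + (s - r) = t - r by ring, div_self h.ne', one_smul]
  · field_simp
    ring

/-- A point behind `a + s • d`, as seen from `a + r • d` with `r < s`, lies further out on the ray
in direction `d`. -/
theorem exists_eq_add_smul_of_mem_openSegment {a d z : E} {r s : ℝ} (hrs : r < s)
    (h : a + s • d ∈ openSegment ℝ (a + r • d) z) : ∃ t, s < t ∧ z = a + t • d := by
  obtain ⟨α, β, hα, hβ, hαβ, h⟩ := h
  obtain rfl : α = 1 - β := by linarith
  refine ⟨r + (s - r) / β, ?_, ?_⟩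
  · have : s - r < (s - r) / β := by
      rw [lt_div_iff₀ hβ]
      nlinarith
    linarith
  · have h2 : β • z = β • (a + (r + (s - r) / β) • d) := by
      have e : β * (r + (s - r) / β) = β * r + (s - r) := by field_simp
      rw [eq_sub_of_add_eq' h, smul_add β, smul_smul, e]
      module
    exact smul_right_injective E hβ.ne' h2

/-- Two distinct points strictly on the same side of `b` on a line: one of them lies between `b`
and the other. -/
theorem mem_openSegment_or_of_common_right {b x y z : E} (hx : b ∈ openSegment ℝ x z)
    (hy : b ∈ openSegment ℝ y z) (hxy : x ≠ y) :
    x ∈ openSegment ℝ b y ∨ y ∈ openSegment ℝ b x := by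
  have key : ∀ w, b ∈ openSegment ℝ w z → ∃ t : ℝ, 0 < t ∧ w = b + t • (b - z) := by
    intro w hw
    rw [openSegment_symm] at hw
    have h : z + (1 : ℝ) • (b - z) ∈ openSegment ℝ (z + (0 : ℝ) • (b - z)) w := by simpa using hw
    obtain ⟨t, ht, e⟩ := exists_eq_add_smul_of_mem_openSegment one_pos.gt h
    exact ⟨t - 1, by linarith, by rw [e]; module⟩
  obtain ⟨s, hs, rfl⟩ := key x hx
  obtain ⟨t, ht, rfl⟩ := key y hy
  have h0 : b = b + (0 : ℝ) • (b - z) := by simp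
  rcases lt_trichotomy s t with h | rfl | h
  · left
    have := add_smul_mem_openSegment b (b - z) hs h
    rwa [← h0] at this
  · exact absurd rfl hxy
  · right
    have := add_smul_mem_openSegment b (b - z) ht h
    rwa [← h0] at this

end Line

/-! ### Segment ends -/

namespace SimpleGraph.StraightLineDrawing

variable {V : Type*} {G : SimpleGraph V}

/-- The edge `vw` is drawn with a segment end at `v`: no edge at `v` prolongs it beyond `v`. -/
def IsEnd (D : G.StraightLineDrawing) (v w : V) : Prop :=
  G.Adj v w ∧ ∀ u, G.Adj v u → D.pos v ∉ openSegment ℝ (D.pos w) (D.pos u)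

theorem cover_singleton (D : G.StraightLineDrawing) (a b : V) :
    D.cover {s(a, b)} = segment ℝ (D.pos a) (D.pos b) := by
  ext z
  constructor
  · rintro ⟨c, d, h, hz⟩
    rcases Sym2.eq_iff.1 (Set.mem_singleton_iff.1 h) with ⟨rfl, rfl⟩ | ⟨rfl, rfl⟩
    · exact hz
    · rwa [segment_symm]
  · exact fun hz => ⟨a, b, rfl, hz⟩

theorem exists_mem_segments [Finite V] (D : G.StraightLineDrawing) {a b : V} (h : G.Adj a b) :
    ∃ S ∈ D.segments, s(a, b) ∈ S := by
  have h1 : D.FormsLineSegment {s(a, b)} :=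
    ⟨by simpa using h, _, _, D.cover_singleton a b⟩
  obtain ⟨S, hS, hm⟩ := (Set.toFinite {S | D.FormsLineSegment S}).exists_le_maximal h1
  exact ⟨S, hm, hS rfl⟩

theorem pos_mem_cover (D : G.StraightLineDrawing) {S : Set (Sym2 V)} {a b : V}
    (h : s(a, b) ∈ S) : D.pos a ∈ D.cover S ∧ D.pos b ∈ D.cover S :=
  ⟨⟨a, b, h, left_mem_segment _ _ _⟩, ⟨a, b, h, right_mem_segment _ _ _⟩⟩

/-- If edges together cover a segment from `x` to `y`, and the vertex `v` on it has one of these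
edges `vw` on its `x`-side and is not `y`, then `vw` is prolonged beyond `v`: points of the segment
just behind `v` are covered by an edge, which must then have `v` as an end. -/
theorem not_isEnd_of_cover [Finite V] {D : G.StraightLineDrawing} (hD : D.CrossingFree)
    {S : Set (Sym2 V)} (hS : S ⊆ G.edgeSet) {x y : Plane} (hc : D.cover S = segment ℝ x y)
    {v w : V} {s t : ℝ} (hv : D.pos v = x + t • (y - x)) (hw : D.pos w = x + s • (y - x))
    (hst : s < t) (ht0 : 0 ≤ t) (ht : t < 1) : ¬ D.IsEnd v w := by
  rintro ⟨-, hend⟩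
  -- Close behind `v` every edge that is met passes through `v`.
  have hev : ∀ᶠ r : ℝ in nhdsWithin 0 (Set.Ioi 0), ∀ e : V × V,
      D.pos v + r • (y - x) ∈ segment ℝ (D.pos e.1) (D.pos e.2) →
        D.pos v ∈ segment ℝ (D.pos e.1) (D.pos e.2) := by
    rw [Filter.eventually_all]
    rintro ⟨a, b⟩
    by_cases h : D.pos v ∈ segment ℝ (D.pos a) (D.pos b)
    · exact Filter.Eventually.of_forall fun _ _ => h
    have hcl : IsClosed (segment ℝ (D.pos a) (D.pos b)) := by
      rw [segment_eq_image]
      exact (isCompact_Icc.image (by fun_prop)).isClosed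
    have hcont : Continuous fun r : ℝ => D.pos v + r • (y - x) := by fun_prop
    have ho : IsOpen {r : ℝ | D.pos v + r • (y - x) ∉ segment ℝ (D.pos a) (D.pos b)} :=
      hcl.isOpen_compl.preimage hcont
    have h0 : (0 : ℝ) ∈ {r : ℝ | D.pos v + r • (y - x) ∉ segment ℝ (D.pos a) (D.pos b)} := by
      simpa using h
    filter_upwards [mem_nhdsWithin_of_mem_nhds (ho.mem_nhds h0)] with r hr h'
    exact absurd h' hr
  have hsmall : ∀ᶠ r : ℝ in nhdsWithin 0 (Set.Ioi 0), r ∈ Set.Ioo 0 (1 - t) :=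
    Ioo_mem_nhdsGT (by linarith)
  obtain ⟨r, hr, hr0, hr1⟩ := (hev.and hsmall).exists
  have hq : D.pos v + r • (y - x) ∈ D.cover S := by
    rw [hc, segment_eq_image']
    exact ⟨t + r, ⟨by linarith, by linarith⟩, by simp only; rw [hv]; module⟩
  obtain ⟨a, b, hab, hq⟩ := hq
  have hne : y - x ≠ 0 := by
    intro h0
    rw [h0, smul_zero] at hv hw
    have hvw : v = w := D.pos_injective (hv.trans hw.symm)
    subst hvw
    obtain ⟨h1, -⟩ := pos_mem_cover D hab
    obtain ⟨-, h2⟩ := pos_mem_cover D hab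
    rw [hc, sub_eq_zero.1 h0, segment_same, Set.mem_singleton_iff] at h1 h2
    exact G.loopless.irrefl a (by
      have := D.pos_injective (h1.trans h2.symm)
      have hadj : G.Adj a b := hS hab
      rwa [← this] at hadj)
  -- The edge found has `v` as one end, so its other end `c` continues the line beyond `v`.
  have key : ∀ c, G.Adj v c → D.pos v + r • (y - x) ∈ segment ℝ (D.pos v) (D.pos c) → False := by
    intro c hvc hq
    apply hend c hvc
    rw [segment_eq_image'] at hq
    obtain ⟨μ, ⟨hμ0, -⟩, hμ⟩ := hq
    have hμ : μ • (D.pos c - D.pos v) = r • (y - x) := add_left_cancel hμ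
    have hμ0 : 0 < μ := by
      rcases hμ0.lt_or_eq with h | h
      · exact h
      · rw [← h, zero_smul] at hμ
        exact absurd hμ.symm (smul_ne_zero hr0.ne' hne)
    have hcpos : D.pos c = x + (t + r / μ) • (y - x) := by
      have : D.pos c - D.pos v = (r / μ) • (y - x) := by
        rw [div_eq_inv_mul, mul_smul, ← hμ, smul_smul, inv_mul_cancel₀ hμ0.ne', one_smul]
      rw [add_smul, ← this, ← add_assoc, ← hv]
      abel
    rw [hv, hw, hcpos]
    exact add_smul_mem_openSegment _ _ hst (by have := div_pos hr0 hμ0; linarith)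
  have hadj : G.Adj a b := hS hab
  have hvseg := hr (a, b) hq
  simp only at hvseg
  rw [← insert_endpoints_openSegment] at hvseg
  rcases hvseg with h | h | h
  · obtain rfl := D.pos_injective h
    exact key b hadj hq
  · obtain rfl := D.pos_injective h
    rw [segment_symm] at hq
    exact key a hadj.symm hq
  · exact hD.1 a b v hadj h

theorem eq_or_eq_of_isEnd [Finite V] {D : G.StraightLineDrawing} (hD : D.CrossingFree)
    {S : Set (Sym2 V)} (hS : S ⊆ G.edgeSet) {x y : Plane} (hc : D.cover S = segment ℝ x y)
    {v w : V} (hvw : s(v, w) ∈ S) (hend : D.IsEnd v w) : D.pos v = x ∨ D.pos v = y := by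
  obtain ⟨hv, hw⟩ := pos_mem_cover D hvw
  rw [hc, segment_eq_image'] at hv hw
  obtain ⟨t, ⟨ht0, ht1⟩, hv⟩ := hv
  obtain ⟨s, ⟨hs0, hs1⟩, hw⟩ := hw
  simp only at hv hw
  by_contra! hne
  have ht0' : t ≠ 0 := by
    rintro rfl
    exact hne.1 (by rw [← hv]; simp)
  have ht1' : t ≠ 1 := by
    rintro rfl
    exact hne.2 (by rw [← hv]; simp)
  rcases lt_trichotomy s t with h | rfl | h
  · exact not_isEnd_of_cover hD hS hc hv.symm hw.symm h ht0 (lt_of_le_of_ne ht1 ht1') hend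
  · exact hend.1.ne (D.pos_injective (hv.symm.trans hw))
  · rw [segment_symm] at hc
    refine not_isEnd_of_cover hD hS hc (t := 1 - t) (s := 1 - s) ?_ ?_ (by linarith) (by linarith)
      (by linarith [lt_of_le_of_ne ht0 ht0'.symm]) hend
    · rw [← hv]; module
    · rw [← hw]; module

/-- Two edges leaving `v` in the same direction coincide. -/
theorem eq_of_cover_of_pos_eq {D : G.StraightLineDrawing} (hD : D.CrossingFree)
    {S : Set (Sym2 V)} (hS : S ⊆ G.edgeSet) {x y : Plane} (hc : D.cover S = segment ℝ x y)
    {v w w' : V} (hvw : s(v, w) ∈ S) (hvw' : s(v, w') ∈ S) (hx : D.pos v = x) : w = w' := by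
  have key : ∀ w, s(v, w) ∈ S → ∃ t : ℝ, 0 < t ∧ D.pos w = D.pos v + t • (y - x) := by
    intro w hvw
    obtain ⟨-, hw⟩ := pos_mem_cover D hvw
    rw [hc, segment_eq_image'] at hw
    obtain ⟨t, ⟨ht0, -⟩, hw⟩ := hw
    refine ⟨t, lt_of_le_of_ne ht0 ?_, by rw [hx]; exact hw.symm⟩
    rintro rfl
    have hadj : G.Adj v w := hS hvw
    exact hadj.ne (D.pos_injective (by rw [hx, ← hw]; simp))
  obtain ⟨s, hs, hw⟩ := key w hvw
  obtain ⟨t, ht, hw'⟩ := key w' hvw'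
  have h0 : D.pos v + (0 : ℝ) • (y - x) = D.pos v := by simp
  rcases lt_trichotomy s t with h | rfl | h
  · have := add_smul_mem_openSegment (D.pos v) (y - x) hs h
    rw [h0, ← hw, ← hw'] at this
    exact absurd this (hD.1 _ _ _ (hS hvw'))
  · exact D.pos_injective (hw.trans hw'.symm)
  · have := add_smul_mem_openSegment (D.pos v) (y - x) ht h
    rw [h0, ← hw, ← hw'] at this
    exact absurd this (hD.1 _ _ _ (hS hvw))

/-- A segment has two ends, so there are at most twice as many pairs of a vertex and an edge ending
there as there are segments. -/
theorem card_le_two_mul_segmentNumber [Finite V] {D : G.StraightLineDrawing}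
    (hD : D.CrossingFree) (A : Finset (V × V)) (hA : ∀ e ∈ A, D.IsEnd e.1 e.2) :
    A.card ≤ 2 * D.segmentNumber := by
  classical
  have hex : ∀ e : V × V, ∃ S, D.IsEnd e.1 e.2 → S ∈ D.segments ∧ s(e.1, e.2) ∈ S := by
    intro e
    by_cases h : D.IsEnd e.1 e.2
    · obtain ⟨S, h1, h2⟩ := D.exists_mem_segments h.1
      exact ⟨S, fun _ => ⟨h1, h2⟩⟩
    · exact ⟨∅, fun h' => absurd h' h⟩
  choose f hf using hex
  have hfin : D.segments.Finite := Set.toFinite _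
  rw [segmentNumber, Set.ncard_eq_toFinset_card _ hfin]
  refine Finset.card_le_mul_card_image_of_maps_to (f := f) (fun e he => ?_) 2 ?_
  · exact hfin.mem_toFinset.2 (hf e (hA e he)).1
  · intro S hS
    have hS : Maximal D.FormsLineSegment S := hfin.mem_toFinset.1 hS
    obtain ⟨hSG, x, y, hc⟩ := hS.prop
    have hmem : ∀ e ∈ A.filter (f · = S), D.IsEnd e.1 e.2 ∧ s(e.1, e.2) ∈ S := by
      intro e he
      rw [Finset.mem_filter] at he
      have h1 := hA e he.1
      exact ⟨h1, he.2 ▸ (hf e h1).2⟩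
    refine (Finset.card_le_card_of_injOn (t := {x, y}) (fun e => D.pos e.1) ?_ ?_).trans
      Finset.card_le_two
    · intro e he
      obtain ⟨h1, h2⟩ := hmem e he
      simpa using eq_or_eq_of_isEnd hD hSG hc h2 h1
    · rintro ⟨v, w⟩ he ⟨v', w'⟩ he' h
      obtain ⟨h1, h2⟩ := hmem _ he
      obtain ⟨-, h2'⟩ := hmem _ he'
      obtain rfl : v = v' := D.pos_injective h
      rcases eq_or_eq_of_isEnd hD hSG hc h2 h1 with h | h
      · exact congrArg (Prod.mk v) (eq_of_cover_of_pos_eq hD hSG hc h2 h2' h)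
      · rw [segment_symm] at hc
        exact congrArg (Prod.mk v) (eq_of_cover_of_pos_eq hD hSG hc h2 h2' h)

/-! ### Straight-line drawings are planar drawings -/

theorem CrossingFree.isPlanar {D : G.StraightLineDrawing} (hD : D.CrossingFree) :
    G.IsPlanar := by
  have hadj : ∀ e : G.edgeSet, G.Adj (Quot.out (e : Sym2 V)).1 (Quot.out (e : Sym2 V)).2 := by
    rintro ⟨e, he⟩
    rw [← mem_edgeSet]
    convert he
    exact Quot.out_eq e
  have hout : ∀ e : G.edgeSet, s((Quot.out (e : Sym2 V)).1, (Quot.out (e : Sym2 V)).2) = e :=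
    fun e => Quot.out_eq e.1
  have hline : ∀ (a b : Plane) (t : unitInterval), t ∈ Set.Ioo (0 : unitInterval) 1 →
      AffineMap.lineMap a b (t : ℝ) ∈ openSegment ℝ a b := by
    rintro a b t ⟨h0, h1⟩
    rw [openSegment_eq_image_lineMap]
    exact ⟨t, ⟨by exact_mod_cast h0, by exact_mod_cast h1⟩, rfl⟩
  refine ⟨⟨D.pos, D.pos_injective, fun e =>
    ⟨fun t => AffineMap.lineMap (D.pos (Quot.out (e : Sym2 V)).1) (D.pos (Quot.out (e : Sym2 V)).2)
      (t : ℝ), by fun_prop⟩, ?_, ?_, ?_, ?_⟩⟩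
  · intro e s t h
    exact Subtype.ext (AffineMap.lineMap_injective ℝ
      (fun h' => (hadj e).ne (D.pos_injective h')) h)
  · intro e
    have : {v | v ∈ (e : Sym2 V)} = {(Quot.out (e : Sym2 V)).1, (Quot.out (e : Sym2 V)).2} := by
      ext v
      conv_lhs => rw [← hout e]
      simp
    rw [this, Set.image_pair]
    simp
  · intro e t ht v h
    exact hD.1 _ _ v (hadj e) (h ▸ hline _ _ t ht)
  · intro e f hef
    have hne : s((Quot.out (e : Sym2 V)).1, (Quot.out (e : Sym2 V)).2) ≠
        s((Quot.out (f : Sym2 V)).1, (Quot.out (f : Sym2 V)).2) := by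
      rw [hout, hout]
      exact fun h => hef (Subtype.ext h)
    refine (hD.2 _ _ _ _ (hadj e) (hadj f) hne).mono ?_ ?_ <;>
    · rintro _ ⟨t, ht, rfl⟩
      exact hline _ _ t ht

end SimpleGraph.StraightLineDrawing

/-! ### The square of a cycle -/

namespace SimpleGraph

/-- The vertices of the cycle on `n` vertices, indexed cyclically by the integers. -/
def cyc (n : ℕ) [NeZero n] (k : ℤ) : Fin n :=
  ⟨(k % n).toNat, by
    have h0 : (0 : ℤ) < n := by exact_mod_cast NeZero.pos n
    have := Int.emod_lt_of_pos k h0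
    have := Int.emod_nonneg k h0.ne'
    omega⟩

section Cyc

variable {n : ℕ} [NeZero n]

theorem cyc_val (k : ℤ) : ((cyc n k : Fin n) : ℤ) = k % n := by
  have h0 : (n : ℤ) ≠ 0 := by exact_mod_cast NeZero.ne n
  have := Int.emod_nonneg k h0
  simp only [cyc]
  omega

theorem cyc_eq_iff {a b : ℤ} : cyc n a = cyc n b ↔ (n : ℤ) ∣ b - a := by
  rw [Fin.ext_iff, ← Int.natCast_inj, cyc_val, cyc_val]
  exact Int.modEq_iff_dvd

theorem cyc_coe (v : Fin n) : cyc n (v : ℕ) = v := by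
  rw [Fin.ext_iff, ← Int.natCast_inj, cyc_val]
  exact Int.emod_eq_of_lt (by omega) (by omega)

theorem cyc_add_self (k : ℤ) : cyc n (k + n) = cyc n k := by
  rw [cyc_eq_iff]
  exact ⟨-1, by ring⟩

theorem cycleGraph_adj_cyc (hn : 2 ≤ n) (a b : ℤ) :
    (cycleGraph n).Adj (cyc n a) (cyc n b) ↔ cyc n b = cyc n (a + 1) ∨ cyc n b = cyc n (a - 1) := by
  have hsub : ∀ u v : ℤ, (cyc n u - cyc n v).val = 1 ↔ cyc n u = cyc n (v + 1) := by
    intro u v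
    have h1 : (((cyc n u - cyc n v : Fin n).val : ℕ) : ℤ) = (u - v) % n := by
      rw [Fin.sub_def]
      have hv := (cyc n v).isLt
      push_cast [Nat.cast_sub hv.le]
      rw [cyc_val, cyc_val]
      apply Int.ModEq.eq
      have hu : u % n ≡ u [ZMOD n] := Int.mod_modEq u n
      have hv : v % n ≡ v [ZMOD n] := Int.mod_modEq v n
      have h0 : (n : ℤ) ≡ 0 [ZMOD n] := by simp [Int.ModEq]
      calc (n : ℤ) - v % n + u % n ≡ 0 - v + u [ZMOD n] := (h0.sub hv).add hu
        _ = u - v := by ring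
    rw [cyc_eq_iff, ← Int.natCast_inj, h1, show v + 1 - u = 1 - (u - v) by ring,
      ← Int.modEq_iff_dvd, Int.ModEq, Int.emod_eq_of_lt (a := 1) (by omega) (by omega)]
    rfl
  rw [cycleGraph_adj', hsub, hsub, or_comm]
  refine or_congr Iff.rfl ?_
  rw [cyc_eq_iff, cyc_eq_iff, ← dvd_neg]
  ring_nf

theorem square_cycleGraph_adj (hn : 5 ≤ n) (a b : ℤ) :
    (cycleGraph n).square.Adj (cyc n a) (cyc n b) ↔
      cyc n b = cyc n (a - 2) ∨ cyc n b = cyc n (a - 1) ∨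
        cyc n b = cyc n (a + 1) ∨ cyc n b = cyc n (a + 2) := by
  have hadj := cycleGraph_adj_cyc (n := n) (by omega)
  have hshift : ∀ {a b : ℤ} (d : ℤ), cyc n b = cyc n a → cyc n (b + d) = cyc n (a + d) := by
    intro a b d h
    rw [cyc_eq_iff] at h ⊢
    rwa [add_sub_add_right_eq_sub]
  have hsmall : ∀ d : ℤ, d ≠ 0 → |d| < n → cyc n (a + d) ≠ cyc n a := by
    intro d hd hlt h
    rw [eq_comm, cyc_eq_iff, add_sub_cancel_left] at h
    exact hd (Int.eq_zero_of_abs_lt_dvd h hlt)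
  have hle : ∀ u v : Fin n, (cycleGraph n).edist u v ≤ 2 ↔
      u = v ∨ (cycleGraph n).Adj u v ∨ ∃ w, (cycleGraph n).Adj u w ∧ (cycleGraph n).Adj w v := by
    intro u v
    constructor
    · intro h
      rw [← not_lt, two_lt_edist_iff] at h
      by_contra! h'
      refine h ⟨h'.1, h'.2.1, ?_⟩
      rw [Set.eq_empty_iff_forall_notMem]
      intro w hw
      rw [mem_commonNeighbors] at hw
      exact h'.2.2 w hw.1 hw.2.symm
    · rintro (rfl | h | ⟨w, h1, h2⟩)
      · simp
      · exact (Walk.edist_le h.toWalk).trans (by simp)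
      · exact (Walk.edist_le (.cons h1 h2.toWalk)).trans (by simp)
  change cyc n a ≠ cyc n b ∧ _ ↔ _
  rw [hle]
  constructor
  · rintro ⟨hne, h | h | ⟨w, h1, h2⟩⟩
    · exact absurd h hne
    · rw [hadj] at h
      tauto
    · rw [← cyc_coe w, hadj] at h1 h2
      rcases h1 with h1 | h1 <;> rcases h2 with h2 | h2
      · right; right; right
        rw [h2, hshift 1 h1]; ring_nf
      · exact absurd (by rw [h2, sub_eq_add_neg, hshift (-1) h1]; ring_nf) hne
      · exact absurd (by rw [h2, hshift 1 h1]; ring_nf) hne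
      · left
        rw [h2, sub_eq_add_neg, hshift (-1) h1]; ring_nf
  · intro h
    refine ⟨?_, ?_⟩
    · rcases h with h | h | h | h <;> rw [h, ne_comm]
      · exact hsmall (-2) (by norm_num) (by norm_num; omega)
      · exact hsmall (-1) (by norm_num) (by norm_num; omega)
      · exact hsmall 1 (by norm_num) (by norm_num; omega)
      · exact hsmall 2 (by norm_num) (by norm_num; omega)
    · right
      rcases h with h | h | h | h
      · refine Or.inr ⟨cyc n (a - 1), ?_, ?_⟩
        · exact (hadj _ _).2 (Or.inr rfl)
        · rw [h]
          refine (hadj _ _).2 (Or.inr ?_)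
          ring_nf
      · exact Or.inl ((hadj _ _).2 (Or.inr h))
      · exact Or.inl ((hadj _ _).2 (Or.inl h))
      · refine Or.inr ⟨cyc n (a + 1), ?_, ?_⟩
        · exact (hadj _ _).2 (Or.inl rfl)
        · rw [h]
          refine (hadj _ _).2 (Or.inl ?_)
          ring_nf

theorem cyc_add_ne (k : ℤ) {d e : ℤ} (hde : d ≠ e) (hlt : |e - d| < n) :
    cyc n (k + d) ≠ cyc n (k + e) := by
  intro h
  rw [cyc_eq_iff, add_sub_add_left_eq_sub] at h
  exact hde (sub_eq_zero.1 (Int.eq_zero_of_abs_lt_dvd h hlt)).symm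

theorem square_cycleGraph_isRegular (hn : 5 ≤ n) [(cycleGraph n).square.LocallyFinite] :
    (cycleGraph n).square.IsRegularOfDegree 4 := by
  intro v
  rw [← card_neighborSet_eq_degree, ← Nat.card_eq_fintype_card, Nat.card_coe_set_eq]
  obtain ⟨k, rfl⟩ : ∃ k : ℤ, v = cyc n k := ⟨_, (cyc_coe v).symm⟩
  have h : (cycleGraph n).square.neighborSet (cyc n k) =
      {cyc n (k + -2), cyc n (k + -1), cyc n (k + 1), cyc n (k + 2)} := by
    ext w
    obtain ⟨l, rfl⟩ : ∃ l : ℤ, w = cyc n l := ⟨_, (cyc_coe w).symm⟩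
    rw [mem_neighborSet, square_cycleGraph_adj hn]
    rfl
  rw [h, Set.ncard_insert_of_notMem, Set.ncard_insert_of_notMem, Set.ncard_pair]
  · exact cyc_add_ne k (by norm_num) (by norm_num; omega)
  · simp only [Set.mem_insert_iff, Set.mem_singleton_iff, not_or]
    exact ⟨cyc_add_ne k (by norm_num) (by norm_num; omega),
      cyc_add_ne k (by norm_num) (by norm_num; omega)⟩
  · simp only [Set.mem_insert_iff, Set.mem_singleton_iff, not_or]
    exact ⟨cyc_add_ne k (by norm_num) (by norm_num; omega),
      cyc_add_ne k (by norm_num) (by norm_num; omega),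
      cyc_add_ne k (by norm_num) (by norm_num; omega)⟩

/-- Walking once around the cycle from `b` with steps of length one and two reaches every
vertex outside `S`, as long as no two consecutive vertices belong to `S`. -/
theorem reachable_compl (hn : 5 ≤ n) (S : Set (Fin n)) (b : ℤ) (hb : cyc n b ∈ Sᶜ) (k : ℕ)
    (hS : ∀ j : ℕ, j < k → ¬ (cyc n (b + j) ∈ S ∧ cyc n (b + j + 1) ∈ S))
    (hk : cyc n (b + k) ∈ Sᶜ) :
    ((cycleGraph n).square.induce Sᶜ).Reachable ⟨_, hb⟩ ⟨_, hk⟩ := by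
  induction k using Nat.strong_induction_on with
  | _ k ih =>
    have hstep : ∀ (l : ℕ) (_ : l < k) (hl : cyc n (b + l) ∈ Sᶜ),
        (cycleGraph n).square.Adj (cyc n (b + l)) (cyc n (b + k)) →
        ((cycleGraph n).square.induce Sᶜ).Reachable ⟨_, hb⟩ ⟨_, hk⟩ := fun l hlk hl hadj =>
      (ih l hlk (fun j hj => hS j (hj.trans hlk)) hl).trans (Adj.reachable hadj)
    match k with
    | 0 =>
      have : (⟨_, hb⟩ : (Sᶜ : Set (Fin n))) = ⟨_, hk⟩ := Subtype.ext (by simp)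
      rw [this]
    | k + 1 =>
      by_cases h : cyc n (b + k) ∈ S
      · match k with
        | 0 => exact absurd (by simpa using h) hb
        | k + 1 =>
          refine hstep k (by omega) (fun h' => hS k (by omega) ⟨h', ?_⟩) ?_
          · convert h using 2
            push_cast; ring
          · rw [square_cycleGraph_adj hn]
            right; right; right
            congr 1
            push_cast; ring
      · refine hstep k (by omega) h ?_
        rw [square_cycleGraph_adj hn]
        right; right; left
        congr 1
        push_cast; ring

theorem square_cycleGraph_isVertexConnected (hn : 5 ≤ n) :
    (cycleGraph n).square.IsVertexConnected 3 := by
  refine ⟨?_, fun S hS => ?_⟩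
  · simp only [ENat.card_eq_coe_fintype_card, Fintype.card_fin]
    exact_mod_cast (by omega : 3 < n)
  -- It suffices to walk around from a suitable base vertex.
  have main : ∀ b : ℤ, cyc n b ∈ ((S : Set (Fin n))ᶜ) → (∀ k : ℕ, k < n →
      cyc n (b + k) ∈ ((S : Set (Fin n))ᶜ) → ∀ j : ℕ, j < k →
        ¬ (cyc n (b + j) ∈ (S : Set (Fin n)) ∧ cyc n (b + j + 1) ∈ (S : Set (Fin n)))) →
      ((cycleGraph n).square.induce (S : Set (Fin n))ᶜ).Connected := by
    intro b hb h
    rw [connected_iff_exists_forall_reachable]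
    refine ⟨⟨_, hb⟩, fun ⟨w, hw⟩ => ?_⟩
    have h0 : (0 : ℤ) < n := by omega
    have h1 := Int.emod_nonneg ((w : ℕ) - b) h0.ne'
    have h2 := Int.emod_lt_of_pos ((w : ℕ) - b) h0
    obtain ⟨k, hk⟩ := Int.eq_ofNat_of_zero_le h1
    have hwk : w = cyc n (b + k) := by
      rw [← cyc_coe w, cyc_eq_iff, ← hk]
      have := Int.emod_add_mul_ediv ((w : ℕ) - b) n
      refine ⟨-(((w : ℕ) - b) / n), ?_⟩
      linarith
    subst hwk
    exact reachable_compl hn _ b hb k (h k (by omega) hw) hw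
  by_cases hc : ∃ a : ℤ, cyc n a ∈ S ∧ cyc n (a + 1) ∈ S
  · -- Two deleted vertices are consecutive: the others form a path with steps of length one.
    obtain ⟨a, ha, ha1⟩ := hc
    have hS2 : S = {cyc n a, cyc n (a + 1)} := by
      symm
      apply Finset.eq_of_subset_of_card_le
      · intro x hx
        simp only [Finset.mem_insert, Finset.mem_singleton] at hx
        rcases hx with rfl | rfl <;> assumption
      · rw [Finset.card_pair]
        · omega
        · have := cyc_add_ne (n := n) a (d := 0) (e := 1) (by norm_num) (by norm_num; omega)
          rwa [add_zero] at this
    have hmem : ∀ d : ℤ, 2 ≤ d → d < n → cyc n (a + d) ∉ (S : Set (Fin n)) := by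
      intro d hd hdn h
      have h0 := cyc_add_ne (n := n) a (d := d) (e := 0) (by omega) (by rw [abs_lt]; omega)
      have h1 := cyc_add_ne (n := n) a (d := d) (e := 1) (by omega) (by rw [abs_lt]; omega)
      rw [add_zero] at h0
      simp [hS2, h0, h1] at h
    refine main (a + 2) (hmem 2 le_rfl (by omega)) fun k hk hkS j hj hjS => ?_
    by_cases hj' : (j : ℤ) + 2 < n
    · exact hmem (2 + j) (by omega) (by omega) (by rw [← add_assoc]; exact hjS.1)
    · -- Here `k = n - 1`, and `a + 2 + k` is the deleted vertex `a + 1`.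
      refine hkS ?_
      have : cyc n (a + 2 + k) = cyc n (a + 1) := by
        rw [cyc_eq_iff]
        exact ⟨-1, by omega⟩
      rw [this]
      exact ha1
  · push Not at hc
    obtain ⟨b, hb⟩ : ∃ b : ℤ, cyc n b ∉ S := by
      by_cases h0 : cyc n 0 ∈ S
      · exact ⟨0 + 1, hc 0 h0⟩
      · exact ⟨0, h0⟩
    exact main b (by simpa using hb) fun k _ _ j _ h => hc _ h.1 h.2

end Cyc

end SimpleGraph

/-! ### Straight pairs at the vertices of a cycle square -/

/-- A sequence of points in which consecutive points and points two steps apart are joined by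
straight edges, with no point of the sequence in the interior of an edge. -/
structure StripDrawing (p : ℤ → Plane) : Prop where
  ne_one : ∀ k, p k ≠ p (k + 1)
  ne_two : ∀ k, p k ≠ p (k + 2)
  notMem_one : ∀ j k, p j ∉ openSegment ℝ (p k) (p (k + 1))
  notMem_two : ∀ j k, p j ∉ openSegment ℝ (p k) (p (k + 2))

/-- The edges to `k - 2` and `k + 1` are aligned at `k`. -/
def AlignedL (p : ℤ → Plane) (k : ℤ) : Prop := p k ∈ openSegment ℝ (p (k - 2)) (p (k + 1))

/-- The edges to `k - 1` and `k + 2` are aligned at `k`. -/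
def AlignedR (p : ℤ → Plane) (k : ℤ) : Prop := p k ∈ openSegment ℝ (p (k - 1)) (p (k + 2))

/-- The edges to `k - 2` and `k + 2` are aligned at `k`. -/
def AlignedO (p : ℤ → Plane) (k : ℤ) : Prop := p k ∈ openSegment ℝ (p (k - 2)) (p (k + 2))

namespace StripDrawing

variable {p : ℤ → Plane}

theorem not_alignedR_of_alignedO (hp : StripDrawing p) {k : ℤ} (hO : AlignedO p k) :
    ¬ AlignedR p k := by
  intro hR
  have h1 := hp.notMem_one (k - 1 - 1) (k - 1)
  have h2 := hp.notMem_two (k - 1) (k - 2)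
  have h3 := hp.ne_one (k - 2)
  rw [openSegment_symm] at h1 h2
  rw [show k - 1 - 1 = k - 2 by ring, show k - 1 + 1 = k by ring] at h1
  rw [show k - 2 + 2 = k by ring] at h2
  rw [show k - 2 + 1 = k - 1 by ring] at h3
  exact (mem_openSegment_or_of_common_right hO hR h3).elim h1 h2

theorem not_alignedL_of_alignedO (hp : StripDrawing p) {k : ℤ} (hO : AlignedO p k) :
    ¬ AlignedL p k := by
  intro hL
  unfold AlignedO at hO
  unfold AlignedL at hL
  rw [openSegment_symm] at hO hL
  have h3 := hp.ne_one (k + 1)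
  rw [show k + 1 + 1 = k + 2 by ring] at h3
  exact (mem_openSegment_or_of_common_right hL hO h3).elim (hp.notMem_two _ _) (hp.notMem_one _ _)

/-- From `p s` issue two different rays, through `p (s + 1)` and `p (s + 2)`. The alignments
force `p (s + 3), p (s + 5), …` on the first and `p (s + 4), p (s + 6), …` on the second, until the
last alignment puts one point on both. -/
theorem not_alignedR_alignedO_alignedL (hp : StripDrawing p) (s : ℤ) (m : ℕ)
    (hR : AlignedR p (s + 1)) (hO : ∀ j : ℕ, j < m → AlignedO p (s + 2 + j))
    (hL : AlignedL p (s + 2 + m)) : False := by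
  set x : ℕ → Plane := fun j => if Even j then p (s + 2) - p s else p (s + 1) - p s with hx
  have hx2 : ∀ j, x (j + 2) = x j := by
    intro j
    simp [hx, Nat.even_add]
  have key : ∀ j : ℕ, j ≤ m + 1 → ∃ c c' : ℝ, 0 ≤ c ∧ c < c' ∧ p (s + j) = p s + c • x j ∧
      p (s + j + 2) = p s + c' • x j := by
    intro j
    induction j using Nat.strong_induction_on with
    | _ j ih =>
      intro hj
      match j with
      | 0 => exact ⟨0, 1, le_rfl, one_pos, by simp, by simp [hx]⟩
      | 1 =>
        have h : p s + (1 : ℝ) • x 1 ∈ openSegment ℝ (p s + (0 : ℝ) • x 1) (p (s + 1 + 2)) := by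
          have := hR
          rw [AlignedR, add_sub_cancel_right] at this
          simpa [hx] using this
        obtain ⟨t, ht, e⟩ := exists_eq_add_smul_of_mem_openSegment one_pos.gt h
        exact ⟨1, t, zero_le_one, ht, by simp [hx], by simpa using e⟩
      | j + 2 =>
        obtain ⟨c, c', hc, hcc, h1, h2⟩ := ih j (by omega) (by omega)
        have h := hO j (by omega)
        rw [AlignedO, show s + 2 + j - 2 = s + j by ring,
          show s + 2 + (j : ℤ) = s + j + 2 by ring, h1, h2] at h
        obtain ⟨t, ht, e⟩ := exists_eq_add_smul_of_mem_openSegment hcc h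
        rw [hx2]
        refine ⟨c', t, by linarith, ht, ?_, ?_⟩
        · rw [← h2]; congr 1; push_cast; ring
        · rw [← e]; congr 1; push_cast; ring
  -- The point `p (s + m + 3)` lies on both rays.
  obtain ⟨c, c', hc, hcc, h1, h2⟩ := key m (by omega)
  obtain ⟨d, d', hd, hdd, -, h4⟩ := key (m + 1) le_rfl
  rw [AlignedL, show s + 2 + m - 2 = s + m by ring,
    show s + 2 + (m : ℤ) = s + m + 2 by ring, h1, h2] at hL
  obtain ⟨t, ht, e⟩ := exists_eq_add_smul_of_mem_openSegment hcc hL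
  rw [show s + (m : ℤ) + 2 + 1 = s + ((m + 1 : ℕ) : ℤ) + 2 by push_cast; ring, h4] at e
  have e : d' • x (m + 1) = t • x m := add_left_cancel e
  have hlam : ∃ l : ℝ, 0 < l ∧ p (s + 1) - p s = l • (p (s + 2) - p s) := by
    have hd' : 0 < d' := by linarith
    have ht' : 0 < t := by linarith
    rcases Nat.even_or_odd m with hm | hm
    · have hm1 : ¬ Even (m + 1) := by simpa [Nat.even_add_one] using hm
      simp only [hx, hm, hm1, if_true, if_false] at e
      refine ⟨t / d', by positivity, ?_⟩
      rw [div_eq_inv_mul, mul_smul, ← e, smul_smul, inv_mul_cancel₀ hd'.ne', one_smul]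
    · have hm1 : Even (m + 1) := hm.add_one
      simp only [hx, Nat.not_even_iff_odd.2 hm, hm1, if_true, if_false] at e
      refine ⟨d' / t, by positivity, ?_⟩
      rw [div_eq_inv_mul, mul_smul, e, smul_smul, inv_mul_cancel₀ ht'.ne', one_smul]
  -- So the two rays coincide, and the triangle at `s` degenerates.
  obtain ⟨l, hl, h⟩ := hlam
  have hp1 : p (s + 1) = p s + l • (p (s + 2) - p s) := by rw [← h]; abel
  have hp2 : p (s + 2) = p s + (1 : ℝ) • (p (s + 2) - p s) := by rw [one_smul]; abel
  have hp0 : p s = p s + (0 : ℝ) • (p (s + 2) - p s) := by simp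
  rcases lt_trichotomy l 1 with h | rfl | h
  · have := add_smul_mem_openSegment (p s) (p (s + 2) - p s) hl h
    rw [← hp1, ← hp2, ← hp0] at this
    exact hp.notMem_two _ _ this
  · have := hp.ne_one (s + 1)
    rw [add_assoc] at this
    exact this (hp1.trans hp2.symm)
  · have := add_smul_mem_openSegment (p s) (p (s + 2) - p s) one_pos h
    rw [← hp1, ← hp2, ← hp0] at this
    exact hp.notMem_one _ _ this

/-- Between a vertex with an `R`-alignment and a later one with an `L`-alignment there is one
without alignments: otherwise, the last vertex with an `R`-alignment before the next vertex with an
`L`-alignment would be followed by `O`-alignments only. -/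
theorem exists_not_aligned_between (hp : StripDrawing p) {k j : ℤ} (hkj : k < j)
    (hR : AlignedR p k) (hL : AlignedL p j) :
    ∃ i, k < i ∧ i < j ∧ ¬ AlignedL p i ∧ ¬ AlignedR p i ∧ ¬ AlignedO p i := by
  by_contra! hno
  have key : ∀ d : ℕ, k + d < j → ∃ (s : ℤ) (m : ℕ), s + m = k + d ∧ AlignedR p s ∧
      ∀ i : ℕ, i < m → AlignedO p (s + 1 + i) := by
    intro d
    induction d with
    | zero => exact fun _ => ⟨k, 0, by simp, hR, by simp⟩
    | succ d ih =>
      intro hd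
      push_cast at hd ⊢
      obtain ⟨s, m, hsm, hRs, hO⟩ := ih (by omega)
      by_cases h : AlignedR p (k + (d + 1))
      · exact ⟨_, 0, by simp, h, by simp⟩
      have hnL : ¬ AlignedL p (k + (d + 1)) := by
        intro hL
        refine hp.not_alignedR_alignedO_alignedL (s - 1) m (by simpa using hRs) ?_ ?_
        · intro i hi
          convert hO i hi using 1
          ring
        · convert hL using 1
          linarith
      have hO' : AlignedO p (k + (d + 1)) := hno _ (by omega) (by omega) hnL h
      refine ⟨s, m + 1, by push_cast; linarith, hRs, fun i hi => ?_⟩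
      rcases Nat.lt_succ_iff_lt_or_eq.1 hi with hi | rfl
      · exact hO i hi
      · convert hO' using 1
        linarith
  obtain ⟨s, m, hsm, hRs, hO⟩ := key (j - k - 1).toNat (by omega)
  refine hp.not_alignedR_alignedO_alignedL (s - 1) m (by simpa using hRs) ?_ ?_
  · intro i hi
    convert hO i hi using 1
    ring
  · convert hL using 1
    omega

/-- In a closed strip of length `n`, at least as many vertices have no aligned pair as have two:
each of the latter is assigned the next of the former. -/
theorem card_aligned_le (hp : StripDrawing p) {n : ℕ} (hper : ∀ k, p (k + n) = p k)
    (X Z : Finset ℕ) (hX : ∀ k, k ∈ X ↔ k < n ∧ AlignedL p k ∧ AlignedR p k)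
    (hZ : ∀ k, k ∈ Z ↔ k < n ∧ ¬ AlignedL p k ∧ ¬ AlignedR p k ∧ ¬ AlignedO p k) :
    X.card ≤ Z.card := by
  classical
  let P : ℤ → Prop := fun i => ¬ AlignedL p i ∧ ¬ AlignedR p i ∧ ¬ AlignedO p i
  have hsh : ∀ k e, p (k + n + e) = p (k + e) := by
    intro k e
    rw [add_right_comm, hper]
  have hperL : ∀ k, AlignedL p (k + n) ↔ AlignedL p k := by
    intro k
    simp only [AlignedL, sub_eq_add_neg, hsh, hper]
  have hperP : ∀ k, P (k + n) ↔ P k := by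
    intro k
    simp only [P, AlignedL, AlignedR, AlignedO, sub_eq_add_neg, hsh, hper]
  have hbetween : ∀ k ∈ X, ∀ j ∈ X, k < j → ∃ i : ℤ, (k : ℤ) < i ∧ i < j ∧ P i :=
    fun k hk j hj hkj => hp.exists_not_aligned_between (by omega) ((hX k).1 hk).2.2
      ((hX j).1 hj).2.1
  have hwrap : ∀ k ∈ X, ∀ j ∈ X, k ≤ j → ∃ i : ℤ, (j : ℤ) < i ∧ i < k + n ∧ P i :=
    fun k hk j hj hkj => hp.exists_not_aligned_between
      (by have := ((hX j).1 hj).1; omega) ((hX j).1 hj).2.2 ((hperL k).2 ((hX k).1 hk).2.1)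
  have hnext : ∀ k ∈ X, ∃ i : ℕ, P i ∧ k < i ∧ ∀ j : ℤ, k < j → P j → i ≤ j := by
    intro k hk
    have hex : ∃ d : ℕ, P (k + d + 1) := by
      obtain ⟨i, h1, -, h⟩ := hwrap k hk k hk le_rfl
      refine ⟨(i - k - 1).toNat, ?_⟩
      convert h using 1
      omega
    have hspec := Nat.find_spec hex
    refine ⟨k + Nat.find hex + 1, by exact_mod_cast hspec, by omega, fun i hki hi => ?_⟩
    have : Nat.find hex ≤ (i - k - 1).toNat := by
      apply Nat.find_min'
      convert hi using 1
      omega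
    omega
  choose! σ hσ using hnext
  have hσn : ∀ k ∈ X, ∀ j ∈ X, k ≤ j → σ j < k + n := by
    intro k hk j hj hkj
    obtain ⟨i, h1, h2, h⟩ := hwrap k hk j hj hkj
    have := (hσ j hj).2.2 i h1 h
    omega
  have hlt : ∀ k ∈ X, k < n := fun k hk => ((hX k).1 hk).1
  have hmod : ∀ i : ℕ, i < n + n → (i % n = i ∧ i < n) ∨ (i % n + n = i ∧ n ≤ i) := by
    intro i hi
    rcases lt_or_ge i n with h | h
    · exact Or.inl ⟨Nat.mod_eq_of_lt h, h⟩
    · right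
      rw [Nat.mod_eq_sub_mod h, Nat.mod_eq_of_lt (by omega)]
      omega
  refine Finset.card_le_card_of_injOn (fun k => σ k % n) ?_ ?_
  · intro k hk
    have hk : k ∈ X := hk
    obtain ⟨h1, h2, -⟩ := hσ k hk
    have h3 := hσn k hk k hk le_rfl
    have := hlt k hk
    have h1' : P ((σ k % n : ℕ) : ℤ) := by
      rcases hmod (σ k) (by omega) with h | h
      · rwa [h.1]
      · rw [← hperP]
        convert h1 using 1
        omega
    exact (hZ _).2 ⟨Nat.mod_lt _ (by omega), h1'⟩
  · have hne : ∀ k ∈ X, ∀ j ∈ X, k < j → σ k % n ≠ σ j % n := by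
      intro k hk j hj hkj h
      obtain ⟨-, h2, h4⟩ := hσ k hk
      obtain ⟨-, h2', -⟩ := hσ j hj
      have h3 := hσn k hk k hk le_rfl
      have h3' := hσn j hj j hj le_rfl
      have := hlt j hj
      obtain ⟨i, hi1, hi2, hi⟩ := hbetween k hk j hj hkj
      have h5 := h4 i hi1 hi
      have h6 := hσn k hk j hj hkj.le
      rcases hmod (σ k) (by omega) with h7 | h7 <;> rcases hmod (σ j) (by omega) with h8 | h8 <;>
        omega
    intro k hk j hj h
    rcases lt_trichotomy k j with hkj | rfl | hkj
    · exact absurd h (hne k hk j hj hkj)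
    · rfl
    · exact absurd h.symm (hne j hj k hk hkj)


end StripDrawing

/-! ### The lower bound -/

namespace SimpleGraph

variable {n : ℕ} [NeZero n]

theorem StraightLineDrawing.CrossingFree.stripDrawing (hn : 5 ≤ n)
    {D : (cycleGraph n).square.StraightLineDrawing} (hD : D.CrossingFree) :
    StripDrawing fun k => D.pos (cyc n k) := by
  have h1 : ∀ k, (cycleGraph n).square.Adj (cyc n k) (cyc n (k + 1)) := fun k =>
    (square_cycleGraph_adj hn _ _).2 (by simp)
  have h2 : ∀ k, (cycleGraph n).square.Adj (cyc n k) (cyc n (k + 2)) := fun k =>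
    (square_cycleGraph_adj hn _ _).2 (by simp)
  exact ⟨fun k h => (h1 k).ne (D.pos_injective h), fun k h => (h2 k).ne (D.pos_injective h),
    fun j k => hD.1 _ _ _ (h1 k), fun j k => hD.1 _ _ _ (h2 k)⟩

/-- The only pairs of edges that can be aligned at a vertex are those of `AlignedL`, `AlignedR`
and `AlignedO`, as the other pairs of neighbours are adjacent. -/
theorem isEnd_cyc (hn : 5 ≤ n) {D : (cycleGraph n).square.StraightLineDrawing}
    (hD : D.CrossingFree) (k : ℤ) :
    (¬ AlignedL (fun k => D.pos (cyc n k)) k → ¬ AlignedO (fun k => D.pos (cyc n k)) k →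
      D.IsEnd (cyc n k) (cyc n (k - 2))) ∧
    (¬ AlignedR (fun k => D.pos (cyc n k)) k → D.IsEnd (cyc n k) (cyc n (k - 1))) ∧
    (¬ AlignedL (fun k => D.pos (cyc n k)) k → D.IsEnd (cyc n k) (cyc n (k + 1))) ∧
    (¬ AlignedR (fun k => D.pos (cyc n k)) k → ¬ AlignedO (fun k => D.pos (cyc n k)) k →
      D.IsEnd (cyc n k) (cyc n (k + 2))) := by
  have hadj := square_cycleGraph_adj (n := n) hn
  have hself : ∀ d, cyc n k ≠ cyc n d → D.pos (cyc n k) ∉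
      openSegment ℝ (D.pos (cyc n d)) (D.pos (cyc n d)) := by
    intro d hd
    rw [openSegment_same]
    exact fun h => hd (D.pos_injective h)
  have a1 : (cycleGraph n).square.Adj (cyc n k) (cyc n (k - 2)) := by simp [hadj]
  have a2 : (cycleGraph n).square.Adj (cyc n k) (cyc n (k - 1)) := by simp [hadj]
  have a3 : (cycleGraph n).square.Adj (cyc n k) (cyc n (k + 1)) := by simp [hadj]
  have a4 : (cycleGraph n).square.Adj (cyc n k) (cyc n (k + 2)) := by simp [hadj]
  have e1 : D.pos (cyc n k) ∉
      openSegment ℝ (D.pos (cyc n (k - 2))) (D.pos (cyc n (k - 1))) := by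
    refine hD.1 _ _ _ ((hadj _ _).2 ?_)
    rw [show k - 2 + 1 = k - 1 by ring]
    simp
  have e2 : D.pos (cyc n k) ∉
      openSegment ℝ (D.pos (cyc n (k - 1))) (D.pos (cyc n (k + 1))) := by
    refine hD.1 _ _ _ ((hadj _ _).2 ?_)
    rw [show k - 1 + 2 = k + 1 by ring]
    simp
  have e3 : D.pos (cyc n k) ∉
      openSegment ℝ (D.pos (cyc n (k + 1))) (D.pos (cyc n (k + 2))) := by
    refine hD.1 _ _ _ ((hadj _ _).2 ?_)
    rw [show k + 1 + 1 = k + 2 by ring]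
    simp
  refine ⟨fun hL hO => ⟨a1, fun u hu => ?_⟩, fun hR => ⟨a2, fun u hu => ?_⟩,
    fun hL => ⟨a3, fun u hu => ?_⟩, fun hR hO => ⟨a4, fun u hu => ?_⟩⟩ <;>
  · rw [← cyc_coe u, hadj, cyc_coe] at hu
    rcases hu with rfl | rfl | rfl | rfl <;>
    first
      | exact hself _ a1.ne
      | exact hself _ a2.ne
      | exact hself _ a3.ne
      | exact hself _ a4.ne
      | assumption
      | (rw [openSegment_symm]; assumption)

/-- Each vertex is the end of at least two segments, except that one with two aligned pairs is the
end of none, and one with no aligned pair is the end of four. The latter make up for the former. -/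
theorem le_segmentNumber_of_crossingFree (hn : 5 ≤ n)
    {D : (cycleGraph n).square.StraightLineDrawing} (hD : D.CrossingFree) :
    n ≤ D.segmentNumber := by
  classical
  set p : ℤ → Plane := fun k => D.pos (cyc n k) with hpdef
  have hp : StripDrawing p := hD.stripDrawing hn
  set X := (Finset.range n).filter fun k : ℕ => AlignedL p k ∧ AlignedR p k with hXdef
  set Z := (Finset.range n).filter
    fun k : ℕ => ¬ AlignedL p k ∧ ¬ AlignedR p k ∧ ¬ AlignedO p k with hZdef
  have hXZ : X.card ≤ Z.card := by
    refine hp.card_aligned_le (n := n) (fun k => ?_) X Z (by simp [hXdef]) (by simp [hZdef])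
    simp only [hpdef, cyc_add_self]
  set A : Finset (Fin n × Fin n) := Finset.univ.filter fun e => D.IsEnd e.1 e.2 with hA
  have hcard : A.card = ∑ k ∈ Finset.range n,
      (Finset.univ.filter fun w => D.IsEnd (cyc n (k : ℕ)) w).card := by
    rw [Finset.sum_range, hA, Finset.card_filter, Fintype.sum_prod_type]
    refine Finset.sum_congr rfl fun v _ => ?_
    rw [cyc_coe, Finset.card_filter]
  have hpoint : ∀ k ∈ Finset.range n, 2 + 2 * (if ¬ AlignedL p k ∧ ¬ AlignedR p k ∧
      ¬ AlignedO p k then 1 else 0) ≤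
      (Finset.univ.filter fun w => D.IsEnd (cyc n (k : ℕ)) w).card +
        2 * (if AlignedL p k ∧ AlignedR p k then 1 else 0) := by
    intro k _
    obtain ⟨h1, h2, h3, h4⟩ := isEnd_cyc hn hD k
    have hle : ∀ s : Finset ℤ, Set.InjOn (cyc n) (s : Set ℤ) →
        (∀ i ∈ s, D.IsEnd (cyc n (k : ℕ)) (cyc n i)) →
        s.card ≤ (Finset.univ.filter fun w => D.IsEnd (cyc n (k : ℕ)) w).card := by
      intro s hs h
      exact Finset.card_le_card_of_injOn (cyc n) (by simpa [Set.MapsTo] using h) hs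
    have hinj : Set.InjOn (cyc n) (Set.Icc ((k : ℤ) - 2) (k + 2)) := by
      rintro a ⟨ha1, ha2⟩ b ⟨hb1, hb2⟩ h
      rw [cyc_eq_iff] at h
      have := Int.eq_zero_of_abs_lt_dvd h (by rw [abs_lt]; omega)
      omega
    have hpair : ∀ a b : ℤ, a < b → (k : ℤ) - 2 ≤ a → b ≤ k + 2 →
        D.IsEnd (cyc n (k : ℕ)) (cyc n a) → D.IsEnd (cyc n (k : ℕ)) (cyc n b) →
        2 ≤ (Finset.univ.filter fun w => D.IsEnd (cyc n (k : ℕ)) w).card := by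
      intro a b hab ha hb hea heb
      rw [← Finset.card_pair hab.ne]
      apply hle
      · refine hinj.mono ?_
        intro i hi
        simp only [Finset.coe_insert, Finset.coe_singleton, Set.mem_insert_iff,
          Set.mem_singleton_iff] at hi
        constructor <;> omega
      · simp only [Finset.mem_insert, Finset.mem_singleton]
        rintro i (rfl | rfl) <;> assumption
    have hOL := hp.not_alignedL_of_alignedO (k := k)
    have hOR := hp.not_alignedR_of_alignedO (k := k)
    by_cases hL : AlignedL p k <;> by_cases hR : AlignedR p k
    · simp [hL, hR]
    · have hO : ¬ AlignedO p k := fun h => hOL h hL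
      simpa [hL, hR] using hpair _ _ (by omega) (by omega) (by omega) (h2 hR) (h4 hR hO)
    · have hO : ¬ AlignedO p k := fun h => hOR h hR
      simpa [hL, hR] using hpair _ _ (by omega) (by omega) (by omega) (h1 hL hO) (h3 hL)
    · by_cases hO : AlignedO p k
      · simpa [hL, hR, hO] using hpair _ _ (by omega) (by omega) (by omega) (h2 hR) (h3 hL)
      · have h := hle {(k : ℤ) - 2, (k : ℤ) - 1, (k : ℤ) + 1, (k : ℤ) + 2} ?_ ?_
        · rw [Finset.card_insert_of_notMem, Finset.card_insert_of_notMem, Finset.card_pair] at h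
          · simpa [hL, hR, hO] using h
          all_goals simp <;> omega
        · refine hinj.mono ?_
          intro i hi
          simp only [Finset.coe_insert, Finset.coe_singleton, Set.mem_insert_iff,
            Set.mem_singleton_iff] at hi
          constructor <;> omega
        · simp only [Finset.mem_insert, Finset.mem_singleton]
          rintro i (rfl | rfl | rfl | rfl)
          exacts [h1 hL hO, h2 hR, h3 hL, h4 hR hO]
  have hsum := Finset.sum_le_sum hpoint
  rw [Finset.sum_add_distrib, Finset.sum_add_distrib, ← Finset.mul_sum, ← Finset.mul_sum,
    ← Finset.card_filter, ← Finset.card_filter, ← hcard, Finset.sum_const, Finset.card_range,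
    smul_eq_mul] at hsum
  have hA2 := StraightLineDrawing.card_le_two_mul_segmentNumber hD A (by simp [hA])
  change n * 2 + 2 * Z.card ≤ A.card + 2 * X.card at hsum
  omega

end SimpleGraph

/-! ### A straight-line drawing of the square of an even cycle -/

theorem disjoint_openSegment_of_separated {a b c d : Plane} (α β γ : ℝ)
    (ha : α * a 0 + β * a 1 + γ ≤ 0) (hb : α * b 0 + β * b 1 + γ ≤ 0)
    (hc : 0 ≤ α * c 0 + β * c 1 + γ) (hd : 0 ≤ α * d 0 + β * d 1 + γ)
    (h : α * a 0 + β * a 1 + γ < 0 ∨ α * b 0 + β * b 1 + γ < 0 ∨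
      0 < α * c 0 + β * c 1 + γ ∨ 0 < α * d 0 + β * d 1 + γ) :
    Disjoint (openSegment ℝ a b) (openSegment ℝ c d) := by
  rw [Set.disjoint_left]
  rintro z ⟨s, t, hs, ht, hst, rfl⟩ ⟨s', t', hs', ht', hst', e⟩
  have e0 : s' * c 0 + t' * d 0 = s * a 0 + t * b 0 := by
    simpa using congrArg (fun z : Plane => z 0) e
  have e1 : s' * c 1 + t' * d 1 = s * a 1 + t * b 1 := by
    simpa using congrArg (fun z : Plane => z 1) e
  have key : s * (α * a 0 + β * a 1 + γ) + t * (α * b 0 + β * b 1 + γ) =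
      s' * (α * c 0 + β * c 1 + γ) + t' * (α * d 0 + β * d 1 + γ) := by
    linear_combination -α * e0 - β * e1 + γ * (hst - hst')
  have h1 := mul_nonpos_of_nonneg_of_nonpos hs.le ha
  have h2 := mul_nonpos_of_nonneg_of_nonpos ht.le hb
  have h3 := mul_nonneg hs'.le hc
  have h4 := mul_nonneg ht'.le hd
  rcases h with h | h | h | h
  · linarith [mul_neg_of_pos_of_neg hs h]
  · linarith [mul_neg_of_pos_of_neg ht h]
  · linarith [mul_pos hs' h]
  · linarith [mul_pos ht' h]

namespace SimpleGraph.SquareCycle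

/-- Abscissa of the vertex `k` in the drawing: vertex `0` is placed in the middle. -/
noncomputable def xCoord (n k : ℕ) : ℝ := if k = 0 then n / 2 else k

/-- Ordinate of the vertex `k` in the drawing: the even vertices other than `0` lie on a horizontal
line, the odd vertices on a flat convex parabola far above it, and the vertex `0` far below. -/
noncomputable def yCoord (n k : ℕ) : ℝ :=
  if k = 0 then -(n : ℝ) ^ 3 else if Even k then 0 else 2 * (n : ℝ) ^ 2 - k * (n - k)

/-- The position of the vertex `k` in the drawing. -/
noncomputable def point (n k : ℕ) : Plane := !₂[xCoord n k, yCoord n k]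

/-- Two pairs of vertices are weakly separated by a line that does not contain all of them. -/
def Sep (n a b c d : ℕ) : Prop :=
  ∃ g : ℕ → ℝ, (∃ α β γ : ℝ, ∀ k, g k = α * xCoord n k + β * yCoord n k + γ) ∧
    g a ≤ 0 ∧ g b ≤ 0 ∧ 0 ≤ g c ∧ 0 ≤ g d ∧ (g a < 0 ∨ g b < 0 ∨ 0 < g c ∨ 0 < g d)

variable {n : ℕ}

theorem Sep.disjoint {a b c d : ℕ} (h : Sep n a b c d) :
    Disjoint (openSegment ℝ (point n a) (point n b)) (openSegment ℝ (point n c) (point n d)) := by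
  obtain ⟨g, ⟨α, β, γ, hg⟩, h1, h2, h3, h4, h5⟩ := h
  simp only [hg] at h1 h2 h3 h4 h5
  exact disjoint_openSegment_of_separated α β γ h1 h2 h3 h4 h5

theorem Sep.symm {a b c d : ℕ} (h : Sep n a b c d) : Sep n c d a b := by
  obtain ⟨g, ⟨α, β, γ, hg⟩, h1, h2, h3, h4, h5⟩ := h
  refine ⟨fun k => -g k, ⟨-α, -β, -γ, fun k => by simp only [hg]; ring⟩, ?_⟩
  simp only [Left.neg_nonpos_iff, Left.nonneg_neg_iff, Left.neg_neg_iff, Left.neg_pos_iff]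
  tauto

theorem xCoord_of_pos {k : ℕ} (hk : 1 ≤ k) : xCoord n k = k := if_neg (by omega)

theorem yCoord_even {k : ℕ} (hk : 1 ≤ k) (h : Even k) : yCoord n k = 0 := by
  rw [yCoord, if_neg (by omega), if_pos h]

theorem yCoord_odd {k : ℕ} (h : ¬ Even k) :
    yCoord n k = 2 * (n : ℝ) ^ 2 - k * (n - k) := by
  rw [yCoord, if_neg (by rintro rfl; exact h .zero), if_neg h]

theorem lt_yCoord_odd {k : ℕ} (hkn : k < n) (h : ¬ Even k) : (n : ℝ) ^ 2 < yCoord n k := by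
  rw [yCoord_odd h]
  have h1 : (k : ℝ) < n := by exact_mod_cast hkn
  nlinarith [Nat.cast_nonneg (α := ℝ) k]

theorem yCoord_nonneg {k : ℕ} (hk : 1 ≤ k) (hkn : k < n) : 0 ≤ yCoord n k := by
  by_cases h : Even k
  · rw [yCoord_even hk h]
  · exact (sq_nonneg (n : ℝ)).trans (lt_yCoord_odd hkn h).le

theorem yCoord_le {k : ℕ} (hkn : k < n) : yCoord n k ≤ 2 * (n : ℝ) ^ 2 := by
  have h1 : (k : ℝ) < n := by exact_mod_cast hkn
  have h2 := Nat.cast_nonneg (α := ℝ) k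
  rw [yCoord]
  split_ifs
  · have : (0 : ℝ) ≤ (n : ℝ) ^ 3 := by positivity
    nlinarith [sq_nonneg (n : ℝ)]
  · positivity
  · nlinarith

/-- The line through two consecutive points separates the earlier points from the later ones. -/
theorem exists_line_consecutive {j : ℕ} (hj : 1 ≤ j) (hjn : j + 1 < n) :
    ∃ g : ℕ → ℝ, (∃ α β γ : ℝ, ∀ k, g k = α * xCoord n k + β * yCoord n k + γ) ∧
      g j = 0 ∧ g (j + 1) = 0 ∧ (∀ i, 1 ≤ i → i < j → g i < 0) ∧
      ∀ i, j + 1 < i → i < n → 0 < g i := by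
  by_cases he : Even j
  · have he1 : ¬ Even (j + 1) := by simpa [Nat.even_add_one] using he
    set h := yCoord n (j + 1) with hh
    have hpos : (n : ℝ) ^ 2 < h := lt_yCoord_odd hjn he1
    have hn2 := sq_nonneg (n : ℝ)
    refine ⟨_, ⟨h, -1, -(h * j), fun k => rfl⟩, ?_, ?_, fun i hi hij => ?_, fun i hij hin => ?_⟩
    · rw [xCoord_of_pos hj, yCoord_even hj he]
      ring
    · rw [xCoord_of_pos (by omega), ← hh]
      push_cast
      ring
    · rw [xCoord_of_pos hi]
      have h1 := yCoord_nonneg (n := n) hi (by omega)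
      have h2 : (i : ℝ) < j := by exact_mod_cast hij
      nlinarith
    · rw [xCoord_of_pos (by omega)]
      by_cases hie : Even i
      · rw [yCoord_even (by omega) hie]
        have h2 : (j : ℝ) < i := by exact_mod_cast (by omega : j < i)
        nlinarith
      · have h1 := yCoord_le hin
        have h3 : j + 3 ≤ i := by
          have : i ≠ j + 2 := by
            rintro rfl
            exact hie (by simpa [Nat.even_add] using he)
          omega
        have h2 : (j : ℝ) + 3 ≤ i := by exact_mod_cast h3
        nlinarith
  · have he1 : Even (j + 1) := by simpa [Nat.even_add_one] using he
    set h := yCoord n j with hh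
    have hpos : (n : ℝ) ^ 2 < h := lt_yCoord_odd (by omega) he
    have hn2 := sq_nonneg (n : ℝ)
    refine ⟨_, ⟨h, 1, -(h * (j + 1)), fun k => rfl⟩, ?_, ?_, fun i hi hij => ?_,
      fun i hij hin => ?_⟩
    · rw [xCoord_of_pos hj, ← hh]
      ring
    · rw [xCoord_of_pos (by omega), yCoord_even (by omega) he1]
      push_cast
      ring
    · rw [xCoord_of_pos hi]
      by_cases hie : Even i
      · rw [yCoord_even hi hie]
        have h2 : (i : ℝ) < j := by exact_mod_cast hij
        nlinarith
      · have h1 := yCoord_le (n := n) (k := i) (by omega)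
        have h3 : i + 2 ≤ j := by
          have : j ≠ i + 1 := by
            rintro rfl
            exact he (by simpa [Nat.even_add_one] using hie)
          omega
        have h2 : (i : ℝ) + 2 ≤ j := by exact_mod_cast h3
        nlinarith
    · rw [xCoord_of_pos (by omega)]
      have h1 := yCoord_nonneg (n := n) (k := i) (by omega) hin
      have h2 : (j : ℝ) + 1 < i := by exact_mod_cast hij
      nlinarith

/-- The edges of the outer triangle of the drawing. -/
def IsOuter (n a b : ℕ) : Prop := (a = 0 ∧ b = 1) ∨ (a = 0 ∧ b = n - 1) ∨ (a = 1 ∧ b = n - 1)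

/-- All other points lie strictly on one side of an edge of the outer triangle. -/
theorem exists_line_outer (hn : 6 ≤ n) (heven : Even n) {a b : ℕ} (h : IsOuter n a b) :
    ∃ g : ℕ → ℝ, (∃ α β γ : ℝ, ∀ k, g k = α * xCoord n k + β * yCoord n k + γ) ∧
      g a = 0 ∧ g b = 0 ∧ ∀ i, i < n → i ≠ a → i ≠ b → 0 < g i := by
  have hn6 : (6 : ℝ) ≤ n := by exact_mod_cast hn
  have hodd : ¬ Even (n - 1) := by
    obtain ⟨m, rfl⟩ := heven
    rw [Nat.not_even_iff]
    omega
  have hcast : ((n - 1 : ℕ) : ℝ) = n - 1 := by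
    rw [Nat.cast_sub (by omega)]
    simp
  have hx1 : xCoord n 1 = 1 := by simp [xCoord]
  have hx0 : xCoord n 0 = n / 2 := by simp [xCoord]
  have hy0 : yCoord n 0 = -(n : ℝ) ^ 3 := by simp [yCoord]
  have hxl : xCoord n (n - 1) = n - 1 := by rw [xCoord_of_pos (by omega), hcast]
  set h1 := 2 * (n : ℝ) ^ 2 - (n - 1) with hh1
  have hy1 : yCoord n 1 = h1 := by
    rw [yCoord_odd (by decide), Nat.cast_one, one_mul]
  have hyl : yCoord n (n - 1) = h1 := by
    rw [yCoord_odd hodd, hcast]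
    ring
  have hpos : 0 < h1 := by nlinarith
  -- The apex lies so low that the line from it to an end of the upper parabola is steep enough.
  have hsteep : 0 < (h1 + (n : ℝ) ^ 3) - h1 * (n / 2 - 1) := by nlinarith
  have hH : 0 < h1 + (n : ℝ) ^ 3 := by positivity
  have hm : 0 < (n : ℝ) / 2 - 1 := by linarith
  rcases h with ⟨rfl, rfl⟩ | ⟨rfl, rfl⟩ | ⟨rfl, rfl⟩
  · refine ⟨_, ⟨h1 + (n : ℝ) ^ 3, n / 2 - 1, -(h1 + (n : ℝ) ^ 3) - h1 * (n / 2 - 1),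
      fun k => rfl⟩, ?_, ?_, fun i hi hi0 hi1 => ?_⟩
    · simp only [hx0, hy0]
      ring
    · simp only [hx1, hy1]
      ring
    · rw [xCoord_of_pos (by omega)]
      have h2 : (2 : ℝ) ≤ i := by exact_mod_cast (by omega : 2 ≤ i)
      have h3 := mul_nonneg hm.le (yCoord_nonneg (n := n) (k := i) (by omega) hi)
      have h4 := mul_le_mul_of_nonneg_left h2 hH.le
      linarith
  · refine ⟨_, ⟨-(h1 + (n : ℝ) ^ 3), n / 2 - 1,
      (h1 + (n : ℝ) ^ 3) * (n - 1) - h1 * (n / 2 - 1), fun k => rfl⟩, ?_, ?_,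
      fun i hi hi0 hi1 => ?_⟩
    · simp only [hx0, hy0]
      ring
    · simp only [hxl, hyl]
      ring
    · rw [xCoord_of_pos (by omega)]
      have h2 : (i : ℝ) + 2 ≤ n := by exact_mod_cast (by omega : i + 2 ≤ n)
      have h3 := mul_nonneg hm.le (yCoord_nonneg (n := n) (k := i) (by omega) hi)
      have h4 := mul_le_mul_of_nonneg_left h2 hH.le
      linarith
  · refine ⟨_, ⟨0, -1, h1, fun k => rfl⟩, ?_, ?_, fun i hi hi0 hi1 => ?_⟩
    · simp only [hy1]
      ring
    · simp only [hyl]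
      ring
    · rcases Nat.eq_zero_or_pos i with rfl | hipos
      · rw [hy0]
        have : 0 < (n : ℝ) ^ 3 := by positivity
        linarith
      · by_cases hie : Even i
        · rw [yCoord_even hipos hie]
          linarith
        · rw [yCoord_odd hie]
          have h2 : (1 : ℝ) < i := by exact_mod_cast (by omega : 1 < i)
          have h3 : (i : ℝ) + 1 < n := by exact_mod_cast (by omega : i + 1 < n)
          nlinarith

/-- The edges of the drawing with the smaller end first: those of the strip, those of the outer
triangle, and two more edges at the apex. -/
def IsEdge (n a b : ℕ) : Prop :=
  a < b ∧ b < n ∧ ((1 ≤ a ∧ b ≤ a + 2) ∨ IsOuter n a b ∨ (a = 0 ∧ b = 2) ∨ (a = 0 ∧ b = n - 2))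

/-- For two edges of the strip, the first of which is lexicographically smaller, a separating line
passes through the points `a + 1` and `a + 2` if the edges begin at different vertices, and through
`a` and `a + 1` otherwise. -/
theorem sep_strip {a b c d : ℕ} (ha : 1 ≤ a) (hab : a < b) (hba : b ≤ a + 2) (hbn : b < n)
    (hc : 1 ≤ c) (hcd : c < d) (hdc : d ≤ c + 2) (hdn : d < n) (h : a < c ∨ (a = c ∧ b < d)) :
    Sep n a b c d := by
  rcases h with h | ⟨rfl, h⟩
  · obtain ⟨g, hg, h1, h2, h3, h4⟩ := exists_line_consecutive (n := n) (j := a + 1) (by omega)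
      (by omega)
    have h5 := h3 a ha (by omega)
    have h6 : g b ≤ 0 := by
      rcases (by omega : b = a + 1 ∨ b = a + 1 + 1) with rfl | rfl
      exacts [h1.le, h2.le]
    have h7 : ∀ i, a < i → i < n → 0 ≤ g i := by
      intro i hi hin
      rcases (by omega : i = a + 1 ∨ i = a + 1 + 1 ∨ a + 1 + 1 < i) with rfl | rfl | h'
      exacts [h1.ge, h2.ge, (h4 i h' hin).le]
    exact ⟨g, hg, h5.le, h6, h7 c h (by omega), h7 d (by omega) hdn, Or.inl h5⟩
  · obtain ⟨g, hg, h1, h2, h3, h4⟩ := exists_line_consecutive (n := n) (j := a) ha (by omega)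
    obtain rfl : b = a + 1 := by omega
    have h5 := h4 d (by omega) hdn
    exact ⟨g, hg, h1.le, h2.le, h1.ge, h5.le, Or.inr (Or.inr (Or.inr h5))⟩

theorem sep_of_isOuter (hn : 6 ≤ n) (heven : Even n) {a b c d : ℕ} (h : IsOuter n a b)
    (hc : c < n) (hd : d < n) (hne : (c ≠ a ∧ c ≠ b) ∨ (d ≠ a ∧ d ≠ b)) : Sep n a b c d := by
  obtain ⟨g, hg, h1, h2, h3⟩ := exists_line_outer hn heven h
  have hnn : ∀ i, i < n → 0 ≤ g i := by
    intro i hi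
    by_cases ha : i = a
    · rw [ha, h1]
    · by_cases hb : i = b
      · rw [hb, h2]
      · exact (h3 i hi ha hb).le
  refine ⟨g, hg, h1.le, h2.le, hnn c hc, hnn d hd, ?_⟩
  rcases hne with ⟨h4, h5⟩ | ⟨h4, h5⟩
  · exact Or.inr (Or.inr (Or.inl (h3 c hc h4 h5)))
  · exact Or.inr (Or.inr (Or.inr (h3 d hd h4 h5)))

/-- The horizontal axis separates an edge from the apex `0` to an even vertex from everything
above. -/
theorem sep_apex {b c d : ℕ} (hb : 1 ≤ b) (hbe : Even b) (hc : 1 ≤ c) (hcn : c < n)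
    (hd : 1 ≤ d) (hdn : d < n) : Sep n 0 b c d := by
  have h0 : yCoord n 0 < 0 := by
    have : 0 < (n : ℝ) := by exact_mod_cast (by omega : 0 < n)
    simp only [yCoord, if_true]
    simp only [Left.neg_neg_iff]
    positivity
  refine ⟨yCoord n, ⟨0, 1, 0, fun k => by ring⟩, h0.le, (yCoord_even hb hbe).le,
    yCoord_nonneg hc hcn, yCoord_nonneg hd hdn, Or.inl h0⟩

theorem sep_of_isEdge_of_lex (hn : 6 ≤ n) (heven : Even n) {a b c d : ℕ} (h : IsEdge n a b)
    (h' : IsEdge n c d) (hlt : a < c ∨ (a = c ∧ b < d)) : Sep n a b c d := by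
  obtain ⟨hab, hbn, h⟩ := h
  obtain ⟨hcd, hdn, h'⟩ := h'
  have he : Even (n - 2) := by
    obtain ⟨m, rfl⟩ := heven
    exact ⟨m - 1, by omega⟩
  by_cases ho : IsOuter n a b
  · exact sep_of_isOuter hn heven ho (by omega) hdn (by omega)
  by_cases ho' : IsOuter n c d
  · exact (sep_of_isOuter hn heven ho' (by omega) hbn (by omega)).symm
  rcases h with ⟨h1, h2⟩ | h | ⟨rfl, rfl⟩ | ⟨rfl, rfl⟩
  · rcases h' with ⟨h3, h4⟩ | h' | h' | h'
    · exact sep_strip h1 hab h2 hbn h3 hcd h4 hdn hlt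
    · exact absurd h' ho'
    · omega
    · omega
  · exact absurd h ho
  · rcases h' with ⟨h3, h4⟩ | h' | h' | ⟨rfl, rfl⟩
    · exact sep_apex (by omega) even_two h3 (by omega) (by omega) hdn
    · exact absurd h' ho'
    · omega
    · -- The edges from the apex to `2` and `n - 2` are separated by a vertical line.
      have hn6 : (6 : ℝ) ≤ n := by exact_mod_cast hn
      refine ⟨fun k => xCoord n k - n / 2, ⟨1, 0, -(n / 2), fun k => by ring⟩, ?_⟩
      have h1 : xCoord n 0 = n / 2 := by simp [xCoord]
      have h2 : xCoord n 2 = 2 := by simp [xCoord]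
      have h3 : xCoord n (n - 2) = n - 2 := by
        rw [xCoord_of_pos (by omega), Nat.cast_sub (by omega)]
        simp
      simp only [h1, h2, h3]
      refine ⟨by linarith, by linarith, by linarith, by linarith, Or.inr (Or.inl (by linarith))⟩
  · rcases h' with ⟨h3, h4⟩ | h' | h' | h'
    · exact sep_apex (by omega) he h3 (by omega) (by omega) hdn
    · exact absurd h' ho'
    · omega
    · omega

theorem sep_of_isEdge (hn : 6 ≤ n) (heven : Even n) {a b c d : ℕ} (h : IsEdge n a b)
    (h' : IsEdge n c d) (hne : ¬ (a = c ∧ b = d)) : Sep n a b c d := by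
  by_cases hlt : a < c ∨ (a = c ∧ b < d)
  · exact sep_of_isEdge_of_lex hn heven h h' hlt
  · exact (sep_of_isEdge_of_lex hn heven h' h (by omega)).symm

theorem sep_of_isEdge_vertex (hn : 6 ≤ n) (heven : Even n) {a b v : ℕ} (h : IsEdge n a b)
    (hv : v < n) (hva : v ≠ a) (hvb : v ≠ b) : Sep n a b v v := by
  obtain ⟨hab, hbn, h⟩ := h
  by_cases ho : IsOuter n a b
  · exact sep_of_isOuter hn heven ho hv hv (Or.inl ⟨hva, hvb⟩)
  rcases h with ⟨h1, h2⟩ | h | ⟨rfl, rfl⟩ | ⟨rfl, rfl⟩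
  · rcases Nat.eq_zero_or_pos v with rfl | hv0
    · refine ⟨fun k => -yCoord n k, ⟨0, -1, 0, fun k => by ring⟩, ?_⟩
      have h3 : 0 < -yCoord n 0 := by
        have : 0 < (n : ℝ) := by exact_mod_cast (by omega : 0 < n)
        simp only [yCoord, if_true, neg_neg]
        positivity
      have h4 := yCoord_nonneg h1 (hab.trans hbn)
      have h5 := yCoord_nonneg (by omega) hbn
      exact ⟨by linarith, by linarith, h3.le, h3.le, Or.inr (Or.inr (Or.inl h3))⟩
    · rcases (by omega : v ≤ a + 1 ∨ a + 1 < v) with hlt | hgt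
      · obtain ⟨g, hg, h3, h4, h5, h6⟩ := exists_line_consecutive (n := n) (j := a) h1 (by omega)
        have hgb : 0 ≤ g b := by
          rcases (by omega : b = a + 1 ∨ a + 1 < b) with rfl | h'
          exacts [h4.ge, (h6 b h' hbn).le]
        refine Sep.symm ⟨g, hg, ?_, ?_, h3.ge, hgb, ?_⟩
        all_goals rcases (by omega : v < a ∨ v = a + 1) with h' | rfl
        · exact (h5 v hv0 h').le
        · exact h4.le
        · exact (h5 v hv0 h').le
        · exact h4.le
        · exact Or.inl (h5 v hv0 h')
        · exact Or.inr (Or.inr (Or.inr (h6 b (by omega) hbn)))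
      · obtain ⟨g, hg, h3, h4, h5, h6⟩ := exists_line_consecutive (n := n) (j := a + 1) (by omega)
          (by omega)
        have hga := h5 a h1 (by omega)
        have hgb : g b ≤ 0 := by
          rcases (by omega : b = a + 1 ∨ b = a + 1 + 1) with rfl | rfl
          exacts [h3.le, h4.le]
        have hgv : 0 ≤ g v := by
          rcases (by omega : v = a + 1 + 1 ∨ a + 1 + 1 < v) with rfl | h'
          exacts [h4.ge, (h6 v h' hv).le]
        exact ⟨g, hg, hga.le, hgb, hgv, hgv, Or.inl hga⟩
  · exact absurd h ho
  · exact sep_apex (by omega) even_two (by omega) hv (by omega) hv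
  · have he : Even (n - 2) := by
      obtain ⟨m, rfl⟩ := heven
      exact ⟨m - 1, by omega⟩
    exact sep_apex (by omega) he (by omega) hv (by omega) hv

theorem point_injOn : Set.InjOn (point n) (Set.Iio n) := by
  intro a ha b hb h
  have hx : xCoord n a = xCoord n b := by simpa [point] using congrArg (fun z : Plane => z 0) h
  have hy : yCoord n a = yCoord n b := by simpa [point] using congrArg (fun z : Plane => z 1) h
  have h0 : ∀ k, 1 ≤ k → k < n → yCoord n 0 ≠ yCoord n k := by
    intro k hk hkn h
    have h1 := yCoord_nonneg hk hkn
    rw [← h] at h1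
    have : 0 < (n : ℝ) := by exact_mod_cast (by omega : 0 < n)
    have : 0 < (n : ℝ) ^ 3 := by positivity
    simp only [yCoord, if_true] at h1
    linarith
  rcases Nat.eq_zero_or_pos a with rfl | ha0 <;> rcases Nat.eq_zero_or_pos b with rfl | hb0
  · rfl
  · exact absurd hy (h0 b hb0 hb)
  · exact absurd hy.symm (h0 a ha0 ha)
  · rw [xCoord_of_pos ha0, xCoord_of_pos hb0] at hx
    exact_mod_cast hx

theorem isEdge_of_adj [NeZero n] (hn : 6 ≤ n) {u v : Fin n} (huv : u < v)
    (h : (cycleGraph n).square.Adj u v) : IsEdge n u v := by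
  rw [← cyc_coe u, ← cyc_coe v, square_cycleGraph_adj (by omega)] at h
  have huv' : (u : ℕ) < v := huv
  have hv := v.isLt
  refine ⟨huv', hv, ?_⟩
  unfold IsOuter
  have hdvd : ∀ e : ℤ, (n : ℤ) ∣ e → -(2 * n) < e → e < n → e = 0 ∨ e = -n := by
    rintro e ⟨c, rfl⟩ h1 h2
    have h3 : c < 1 := by nlinarith
    have h4 : -2 < c := by nlinarith
    obtain rfl | rfl : c = 0 ∨ c = -1 := by omega
    · simp
    · right; ring
  simp only [cyc_eq_iff] at h
  rcases h with h | h | h | h <;> have := hdvd _ h (by omega) (by omega) <;> omega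

/-- The straight-line drawing of the square of the cycle on `n` vertices given by `point`. -/
noncomputable def drawing (n : ℕ) : (cycleGraph n).square.StraightLineDrawing where
  pos v := point n v
  pos_injective _ _ h := Fin.ext (point_injOn (Fin.isLt _) (Fin.isLt _) h)

theorem drawing_crossingFree (hn : 6 ≤ n) (heven : Even n) : (drawing n).CrossingFree := by
  have : NeZero n := ⟨by omega⟩
  -- Orient each edge towards its larger end.
  have horient : ∀ u v : Fin n, (cycleGraph n).square.Adj u v → ∃ a b : Fin n,
      s(a, b) = s(u, v) ∧ IsEdge n a b ∧
        openSegment ℝ (point n u) (point n v) = openSegment ℝ (point n a) (point n b) := by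
    intro u v h
    rcases lt_or_gt_of_ne h.ne with hlt | hlt
    · exact ⟨u, v, rfl, isEdge_of_adj hn hlt h, rfl⟩
    · exact ⟨v, u, Sym2.eq_swap, isEdge_of_adj hn hlt h.symm, openSegment_symm _ _ _⟩
  constructor
  · intro u v w huv
    obtain ⟨a, b, -, hab, heq⟩ := horient u v huv
    change point n w ∉ openSegment ℝ (point n u) (point n v)
    rw [heq]
    have hne : point n a ≠ point n b := fun h => hab.1.ne (point_injOn a.isLt b.isLt h)
    by_cases hwa : (w : ℕ) = a
    · rw [hwa, left_mem_openSegment_iff]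
      exact hne
    by_cases hwb : (w : ℕ) = b
    · rw [hwb, right_mem_openSegment_iff]
      exact hne
    have := (sep_of_isEdge_vertex hn heven hab w.isLt hwa hwb).disjoint
    rw [openSegment_same, Set.disjoint_singleton_right] at this
    exact this
  · intro u v u' v' h h' hne
    obtain ⟨a, b, e, hab, heq⟩ := horient u v h
    obtain ⟨c, d, e', hcd, heq'⟩ := horient u' v' h'
    change Disjoint (openSegment ℝ (point n u) (point n v))
      (openSegment ℝ (point n u') (point n v'))
    rw [heq, heq']
    refine (sep_of_isEdge hn heven hab hcd ?_).disjoint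
    rintro ⟨h1, h2⟩
    rw [← e, ← e', Fin.ext h1, Fin.ext h2] at hne
    exact hne rfl

end SimpleGraph.SquareCycle

/-! ### Segment number, planarity and connectivity combined -/

theorem mainTheorem9 (n : ℕ) (hn : 6 ≤ n) (heven : Even n)
    [(SimpleGraph.cycleGraph n).square.LocallyFinite] :
    (SimpleGraph.cycleGraph n).square.IsPlanar ∧
    (SimpleGraph.cycleGraph n).square.IsRegularOfDegree 4 ∧
    (SimpleGraph.cycleGraph n).square.IsVertexConnected 3 ∧
    n ≤ (SimpleGraph.cycleGraph n).square.segmentNumber ∧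
    (∀ b : ℕ,
      (∀ (G : SimpleGraph (Fin n)) [G.LocallyFinite],
        G.IsPlanar → G.IsRegularOfDegree 4 → G.IsVertexConnected 3 →
          ∃ D : G.StraightLineDrawing, D.CrossingFree ∧ D.segmentNumber ≤ b) →
      n + 3 ≤ b + 3) := by
  have : NeZero n := ⟨by omega⟩
  have hD := SimpleGraph.SquareCycle.drawing_crossingFree hn heven
  have hreg := SimpleGraph.square_cycleGraph_isRegular (n := n) (by omega)
  have hconn := SimpleGraph.square_cycleGraph_isVertexConnected (n := n) (by omega)
  refine ⟨hD.isPlanar, hreg, hconn, ?_, fun b hb => ?_⟩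
  · -- The set of segment numbers is nonempty, so its infimum is attained.
    obtain ⟨D, hD', h⟩ := Nat.sInf_mem
      (s := {k | ∃ D : (SimpleGraph.cycleGraph n).square.StraightLineDrawing,
        D.CrossingFree ∧ D.segmentNumber = k}) ⟨_, _, hD, rfl⟩
    rw [SimpleGraph.segmentNumber, ← h]
    exact SimpleGraph.le_segmentNumber_of_crossingFree (by omega) hD'
  · obtain ⟨D, hD', h⟩ := hb _ hD.isPlanar hreg hconn
    have := SimpleGraph.le_segmentNumber_of_crossingFree (n := n) (by omega) hD'
    omega
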